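/- \textbf{Notation.} For functions $F,G$ of one variable $x$, write $D_x^k\,F\cdot G=\partial_y^k\big(F(x+y)G(x-y)\big)\big|_{y=0}$ (Hirota's bilinear operators). A triple $(\tau_0,\tau_1,\tau_2)$ of entire functions of $x\in\mathbb C$ is said to solve the bilinear fourth Painlevé system with parameters $(\alpha_0,\alpha_1,\alpha_2)\in\mathbb C^3$ if, identically in $x$, $$\Big(D_x^2-xD_x-\tfrac{\alpha_0-\alpha_1}{3}\Big)\tau_0\cdot\tau_1=0,\quad \Big(D_x^2-xD_x-\tfrac{\alpha_1-\alpha_2}{3}\Big)\tau_1\cdot\tau_2=0,\quad \Big(D_x^2-xD_x-\tfrac{\alpha_2-\alpha_0}{3}\Big)\tau_2\cdot\tau_0=0 .$$ For a partition $\lambda=(\lambda_1\ge\lambda_2\ge\cdots)$ of length $l(\lambda)$, the Schur function in the variables $t=(t_1,t_2,\ldots)$ is $S_\lambda(t)=\det\big(p_{\lambda_i-i+j}(t)\big)_{1\le i,j\le l(\lambda)}$, where $\sum_{n\ge0}p_n(t)z^n=\exp\big(\sum_{k\ge1}t_kz^k\big)$ and $p_n=0$ for $n<0$. A Maya diagram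 is a set $M\subset\mathbb Z$ that contains all sufficiently small integers and no sufficiently large integer. Writing $M=\{\cdots<m_3<m_2<m_1\}$, the partition corresponding to $M$ is the unique partition $\lambda$ with $m_i-m_{i+1}=\lambda_i-\lambda_{i+1}+1$ for all $i\ge1$. For $m,n\in\mathbb Z$, let $\lambda(m,n)$ be the partition corresponding to $$M(m,n)=3D_m\cup(3D_n+1)\cup(3D_0+2),\qquad D_l=\{k\in\mathbb Z\mid k<l\},$$ and put $s_{m,n}(x)=S_{\lambda(m,n)}(x,\tfrac12,0,0,\ldots)$. \textbf{Proposition.} Let $m,n\in\mathbb Z$. (1) The triple $(\tau_0,\tau_1,\tau_2)=(s_{m,n},\,s_{m+1,n},\,s_{m+1,n+1})$ solves the bilinear fourth Painlevé system with parameters $(\alpha_0,\alpha_1,\alpha_2)=(3m+1,\;3(n-m)+1,\;-3n+1)$. (2) The triple $(\tau_0,\tau_1,\tau_2)=(s_{m,n},\,s_{m,n+1},\,s_{m+1,n+1})$ solves the bilinear fourth Painlevé system with parameters $(\alpha_0,\alpha_1,\alpha_2)=(3n+2,\;3(m-n)-1,\;-3m+2)$. -/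

import Mathlib

/-! ### Hirota bilinear operators and the bilinear form of the fourth Painlevé equation -/

/-- Hirota's operator `D_x ^ k F · G`, that is
`(d/dy)^k (F (x + y) * G (x - y))` at `y = 0`. -/
noncomputable def hirotaD (k : ℕ) (F G : ℂ → ℂ) (x : ℂ) : ℂ :=
  iteratedDeriv k (fun y : ℂ => F (x + y) * G (x - y)) 0

/-- `(D_x ^ 2 - x D_x - c) F · G` at the point `x`. -/
noncomputable def hirotaPIV (c : ℂ) (F G : ℂ → ℂ) (x : ℂ) : ℂ :=
  hirotaD 2 F G x - x * hirotaD 1 F G x - c * (F x * G x)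

/-- The triple of entire functions `τ₀, τ₁, τ₂` solves the bilinear form of the fourth Painlevé
equation with parameters `α₀, α₁, α₂`. -/
structure SolvesBilinearPIV (α₀ α₁ α₂ : ℂ) (τ₀ τ₁ τ₂ : ℂ → ℂ) : Prop where
  entire₀ : Differentiable ℂ τ₀
  entire₁ : Differentiable ℂ τ₁
  entire₂ : Differentiable ℂ τ₂
  eq₀₁ : ∀ x, hirotaPIV ((α₀ - α₁) / 3) τ₀ τ₁ x = 0
  eq₁₂ : ∀ x, hirotaPIV ((α₁ - α₂) / 3) τ₁ τ₂ x = 0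
  eq₂₀ : ∀ x, hirotaPIV ((α₂ - α₀) / 3) τ₂ τ₀ x = 0

/-! ### Schur functions in the variables `t₁, t₂, …` -/

/-- The power series `∑_{k ≥ 1} t_k z ^ k` in `z`, with coefficients in `ℚ[t₁, t₂, …]`. -/
noncomputable def timeSeries : PowerSeries (MvPolynomial ℕ+ ℚ) :=
  PowerSeries.mk fun k => if h : 0 < k then MvPolynomial.X ⟨k, h⟩ else 0

/-- The series `timeSeries` has no constant term, so it may be substituted in any power series. -/
theorem hasSubst_timeSeries : PowerSeries.HasSubst timeSeries :=
  PowerSeries.HasSubst.of_constantCoeff_zero' (by simp [timeSeries])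

/-- The polynomials `p_n(t)`, `n ∈ ℤ`, with `∑_{n ≥ 0} p_n(t) z ^ n = exp (∑_{k ≥ 1} t_k z ^ k)`
and `p_n(t) = 0` for `n < 0`. -/
noncomputable def pPoly (n : ℤ) : MvPolynomial ℕ+ ℚ :=
  if 0 ≤ n then PowerSeries.coeff n.toNat ((PowerSeries.exp ℚ).subst timeSeries) else 0

/-- The Schur function `S_λ(t) = det (p_{λ_i - i + j}(t))`, `1 ≤ i, j ≤ l(λ)`. The parts of `λ` are
`λ_{i + 1} = μ.rowLen i`, and `μ.colLen 0` is the number of nonzero parts. -/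
noncomputable def schurFunction (μ : YoungDiagram) : MvPolynomial ℕ+ ℚ :=
  Matrix.det (Matrix.of fun i j : Fin (μ.colLen 0) =>
    pPoly ((μ.rowLen i : ℤ) - (i : ℤ) + (j : ℤ)))

/-! ### Maya diagrams and their partitions -/

/-- A Maya diagram is a set of integers that contains all sufficiently small integers and no
sufficiently large one. -/
def IsMaya (M : Set ℤ) : Prop :=
  (∃ a : ℤ, ∀ m < a, m ∈ M) ∧ (∃ b : ℤ, ∀ m > b, m ∉ M)

/-- The partition `μ` corresponds to `M`: if `M = {… < e 2 < e 1 < e 0}`, then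
`e i - e (i + 1) = μ_i - μ_{i + 1} + 1` for all `i`. -/
def MayaCorresponds (M : Set ℤ) (μ : YoungDiagram) : Prop :=
  ∃ e : ℕ → ℤ, StrictAnti e ∧ Set.range e = M ∧
    ∀ i, e i - e (i + 1) = (μ.rowLen i : ℤ) - (μ.rowLen (i + 1) : ℤ) + 1

theorem exists_rowLen_eq_zero (μ : YoungDiagram) : ∃ N, ∀ i ≥ N, μ.rowLen i = 0 := by
  refine ⟨μ.colLen 0, fun i hi => ?_⟩
  by_contra h
  have h1 : (i, 0) ∈ μ := YoungDiagram.mem_iff_lt_rowLen.2 (Nat.pos_of_ne_zero h)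
  have := YoungDiagram.mem_iff_lt_colLen.1 h1
  omega

theorem exists_rowLen_eq (f : ℕ → ℕ) (hf : Antitone f) (N : ℕ) (hN : ∀ i ≥ N, f i = 0) :
    ∃ μ : YoungDiagram, ∀ i, μ.rowLen i = f i := by
  let μ : YoungDiagram :=
    { cells := (Finset.range N ×ˢ Finset.range (f 0)).filter fun c => c.2 < f c.1
      isLowerSet := by
        rintro ⟨a, b⟩ ⟨c, d⟩ hle h
        obtain ⟨hca, hdb⟩ := Prod.mk_le_mk.1 hle
        simp only [Finset.coe_filter, Finset.mem_product, Finset.mem_range, Set.mem_ofPred_eq] at h ⊢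
        have := hf hca
        omega }
  have hmem : ∀ i j, (i, j) ∈ μ ↔ j < f i := by
    intro i j
    rw [← YoungDiagram.mem_cells]
    simp only [μ, Finset.mem_filter, Finset.mem_product, Finset.mem_range]
    constructor
    · exact fun h => h.2
    · intro h
      have h0 := hf (Nat.zero_le i)
      refine ⟨⟨?_, by omega⟩, h⟩
      by_contra hi
      have := hN i (by omega)
      omega
  refine ⟨μ, fun i => ?_⟩
  have h1 := hmem i (μ.rowLen i)
  have h2 := hmem i (f i)
  rw [YoungDiagram.mem_iff_lt_rowLen] at h1 h2
  omega

theorem rowLen_injective {μ ν : YoungDiagram} (h : ∀ i, μ.rowLen i = ν.rowLen i) : μ = ν := by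
  apply YoungDiagram.ext
  ext ⟨i, j⟩
  rw [YoungDiagram.mem_cells, YoungDiagram.mem_cells, YoungDiagram.mem_iff_lt_rowLen,
    YoungDiagram.mem_iff_lt_rowLen, h]

/-- Every Maya diagram has a decreasing enumeration. -/
theorem IsMaya.exists_enum {M : Set ℤ} (hM : IsMaya M) :
    ∃ e : ℕ → ℤ, StrictAnti e ∧ Set.range e = M := by
  obtain ⟨⟨a, ha⟩, ⟨b, hb⟩⟩ := hM
  let p : ℕ → Prop := fun k => b - (k : ℤ) ∈ M
  have hinf : ({k | p k}).Infinite := by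
    apply Set.infinite_of_not_bddAbove
    rintro ⟨c, hc⟩
    have h1 : c + 1 + (b - a).toNat + 1 ∈ {k | p k} := ha _ (by push_cast; omega)
    have := hc h1
    omega
  refine ⟨fun i => b - (Nat.nth p i : ℤ), ?_, ?_⟩
  · intro i j hij
    have : Nat.nth p i < Nat.nth p j := Nat.nth_strictMono hinf hij
    simp only
    omega
  · ext m
    constructor
    · rintro ⟨i, rfl⟩
      exact Nat.nth_mem_of_infinite hinf i
    · intro hm
      have hmb : m ≤ b := by
        by_contra h
        exact hb m (by omega) hm
      have hp : (b - m).toNat ∈ {k | p k} := by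
        change b - ((b - m).toNat : ℤ) ∈ M
        rwa [show b - ((b - m).toNat : ℤ) = m by omega]
      rw [← Nat.range_nth_of_infinite hinf] at hp
      obtain ⟨i, hi⟩ := hp
      exact ⟨i, by simp only [hi]; omega⟩

/-- Every Maya diagram corresponds to exactly one partition. -/
theorem IsMaya.existsUnique_partition {M : Set ℤ} (hM : IsMaya M) :
    ∃! μ : YoungDiagram, MayaCorresponds M μ := by
  apply existsUnique_of_exists_of_unique
  · obtain ⟨e, he, hr⟩ := hM.exists_enum
    obtain ⟨⟨a, ha⟩, -⟩ := hM
    have hstep : ∀ i, e (i + 1) ≤ e i - 1 := fun i => by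
      have := he (show i < i + 1 by omega)
      omega
    have hanti : Antitone fun i : ℕ => e i + (i : ℤ) :=
      antitone_nat_of_succ_le fun i => by
        have := hstep i
        push_cast
        omega
    obtain ⟨N, hN⟩ : ∃ N : ℕ, e N < a := by
      refine ⟨(e 0 - a).toNat + 1, ?_⟩
      have := hanti (Nat.zero_le ((e 0 - a).toNat + 1))
      simp only at this
      push_cast at this
      omega
    have hstable : ∀ i ≥ N, e i + (i : ℤ) = e N + (N : ℤ) := by
      intro i hi
      induction i, hi using Nat.le_induction with
      | base => rfl
      | succ i hi ih =>
        have h1 : e i ≤ e N := he.antitone hi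
        have h2 : e i - 1 ∈ M := ha _ (by omega)
        rw [← hr] at h2
        obtain ⟨j, hj⟩ := h2
        have h3 : i < j := he.lt_iff_gt.1 (by omega)
        have h4 := he.antitone (Nat.succ_le_of_lt h3)
        have h5 := hstep i
        rw [Nat.succ_eq_add_one] at h4
        push_cast
        omega
    have hge : ∀ i : ℕ, e N + (N : ℤ) ≤ e i + (i : ℤ) := by
      intro i
      rcases le_total i N with h | h
      · exact hanti h
      · exact (hstable i h).ge
    obtain ⟨μ, hμ⟩ := exists_rowLen_eq (fun i => (e i + (i : ℤ) - (e N + (N : ℤ))).toNat)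
      (fun i j hij => by
        have := hanti hij
        simp only at this ⊢
        omega) N (fun i hi => by
        have := hstable i hi
        omega)
    refine ⟨μ, e, he, hr, fun i => ?_⟩
    rw [hμ, hμ]
    have h1 := hge i
    have h2 := hge (i + 1)
    push_cast at h2 ⊢
    omega
  · rintro μ ν ⟨e, he, hr, hd⟩ ⟨e', he', hr', hd'⟩
    have hee : e = e' := by
      have h1 : StrictMono fun i => -e i := fun i j h => neg_lt_neg (he h)
      have h2 : StrictMono fun i => -e' i := fun i j h => neg_lt_neg (he' h)
      have h3 : Set.range (fun i => -e i) = Set.range fun i => -e' i := by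
        rw [show (fun i => -e i) = Neg.neg ∘ e from rfl,
          show (fun i => -e' i) = Neg.neg ∘ e' from rfl, Set.range_comp, Set.range_comp, hr, hr']
      have h4 := (StrictMono.range_inj h1 h2).1 h3
      funext i
      exact neg_injective (congrFun h4 i)
    subst hee
    obtain ⟨A, hA⟩ := exists_rowLen_eq_zero μ
    obtain ⟨B, hB⟩ := exists_rowLen_eq_zero ν
    have hconst : ∀ k i, (μ.rowLen i : ℤ) - ν.rowLen i
        = (μ.rowLen (i + k) : ℤ) - ν.rowLen (i + k) := by
      intro k i
      induction k with
      | zero => rfl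
      | succ k ih =>
        have h1 := hd (i + k)
        have h2 := hd' (i + k)
        rw [← Nat.add_assoc]
        omega
    apply rowLen_injective
    intro i
    have h1 := hconst (A + B) i
    rw [hA (i + (A + B)) (by omega), hB (i + (A + B)) (by omega)] at h1
    omega

/-- The partition that corresponds to a Maya diagram. -/
noncomputable def IsMaya.partition {M : Set ℤ} (hM : IsMaya M) : YoungDiagram :=
  hM.existsUnique_partition.choose

theorem IsMaya.partition_spec {M : Set ℤ} (hM : IsMaya M) : MayaCorresponds M hM.partition :=
  hM.existsUnique_partition.choose_spec.1

theorem IsMaya.eq_partition {M : Set ℤ} (hM : IsMaya M) {μ : YoungDiagram}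
    (h : MayaCorresponds M μ) : μ = hM.partition :=
  hM.existsUnique_partition.choose_spec.2 μ h

/-! ### The 3-reduced partitions `λ(m, n)` and the polynomials `s_{m,n}` -/

/-- `M(m, n) = 3 D_m ∪ (3 D_n + 1) ∪ (3 D_0 + 2)`, where `D_l = {k ∈ ℤ | k < l}`. -/
def okamotoMaya (m n : ℤ) : Set ℤ :=
  (fun k : ℤ => 3 * k) '' Set.Iio m ∪ (fun k : ℤ => 3 * k + 1) '' Set.Iio n ∪
    (fun k : ℤ => 3 * k + 2) '' Set.Iio 0

theorem isMaya_okamotoMaya (m n : ℤ) : IsMaya (okamotoMaya m n) := by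
  constructor
  · refine ⟨-(3 * |m| + 3 * |n| + 3), fun k hk => ?_⟩
    have h1 := neg_abs_le m
    have h2 := neg_abs_le n
    have h3 := abs_nonneg m
    have h4 := abs_nonneg n
    have h5 : k % 3 = 0 ∨ k % 3 = 1 ∨ k % 3 = 2 := by omega
    rcases h5 with h | h | h
    · exact Or.inl (Or.inl ⟨k / 3, Set.mem_Iio.2 (by omega), by simp only; omega⟩)
    · exact Or.inl (Or.inr ⟨k / 3, Set.mem_Iio.2 (by omega), by simp only; omega⟩)
    · exact Or.inr ⟨k / 3, Set.mem_Iio.2 (by omega), by simp only; omega⟩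
  · refine ⟨3 * |m| + 3 * |n| + 3, fun k hk hkM => ?_⟩
    have h1 := le_abs_self m
    have h2 := le_abs_self n
    have h3 := abs_nonneg m
    have h4 := abs_nonneg n
    rcases hkM with (⟨j, hj, rfl⟩ | ⟨j, hj, rfl⟩) | ⟨j, hj, rfl⟩ <;>
      simp only [Set.mem_Iio] at hj hk <;> omega

/-- The 3-reduced partition `λ(m, n)`. -/
noncomputable def okamotoPartition (m n : ℤ) : YoungDiagram :=
  (isMaya_okamotoMaya m n).partition

/-- `s_{m,n}(x) = S_{λ(m,n)}(x, 1/2, 0, 0, …)`. -/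
noncomputable def okamotoS (m n : ℤ) (x : ℂ) : ℂ :=
  MvPolynomial.aeval (fun k : ℕ+ => if k = 1 then x else if k = 2 then 1 / 2 else 0)
    (schurFunction (okamotoPartition m n))

/-!
Every equation of the system relates the Schur polynomials `S_M` and `S_{M ∪ {a}}` of two Maya
diagrams that differ by one element, and for all such pairs one has
`(D ^ 2 - x D - c) S_M · S_{M ∪ {a}} = 0`, where `c` is `a` minus the charge of `M`
(`schurPoly_bilinear`). For `M(m, n)` the charge is `m + n`. Adding `3 m` gives `M(m + 1, n)` and
adding `3 n + 1` gives `M(m, n + 1)`. Adding `2` to `M(m + 1, n + 1)` gives `M(m, n) + 3`, which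
has the same partition as `M(m, n)`; this is the equation that closes the triple.

The polynomials `h_k(x) = p_k(x, 1/2, 0, …)` satisfy `h_k' = h_{k-1}` and
`h_k'' + x h_k' = k h_k` (`derivative_hPoly`, `hPoly_sub_two`). By the Jacobi–Trudi formula, `S_M`
is up to sign the determinant of the `h_{b i + j}`, where the `b i` are the elements of `M` above
a level below which `M` is full, shifted by a constant (`schurPoly_eq_hDet`), and
`S_{M ∪ {a}}` has one more row and column. Write `W` and `V` for the two determinants.
Differentiation lowers one index shift at a time, and almost all of the resulting determinants
have a repeated row. Let `W_t` be the sum of the determinants in which one row at a time is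
differentiated twice. The differential equation of the `h_k` gives `W_t = κ W - x W'`, with `κ`
the sum of all `b i` and all row shifts (`sum_hDet_update_sub_two`), and likewise for `V`. Hence the claim is
`(W'' + W_t) V - 2 W' V' + W (V'' - V_t) = 0`. In this form each factor is a single determinant up
to a factor `2`, and after `W` is bordered by a row `(1, 0, …, 0)` the identity is a three-term
Plücker relation (`consDet_plucker`, `hDet_bilinear`).
-/

open Polynomial

/-! ### Determinants -/

/-- The derivative of a determinant, one row at a time. -/
theorem derivative_det_eq_sum_updateRow {n : ℕ} (M : Matrix (Fin n) (Fin n) ℂ[X]) :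
    derivative M.det = ∑ j, (M.updateRow j fun i => derivative (M j i)).det := by
  classical
  simp only [← Matrix.det_transpose M, ← Matrix.det_transpose (Matrix.updateRow _ _ _),
    Matrix.det_apply', derivative_sum]
  rw [Finset.sum_comm]
  refine Finset.sum_congr rfl fun σ _ => ?_
  rw [derivative_intCast_mul, derivative_prod_finset, Finset.mul_sum]
  refine Finset.sum_congr rfl fun j _ => ?_
  congr 1
  rw [← Finset.mul_prod_erase _ _ (Finset.mem_univ j), mul_comm]
  congr 1
  · simp
  · refine Finset.prod_congr rfl fun i hi => ?_
    simp [Matrix.updateRow_ne (Finset.ne_of_mem_erase hi)]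

theorem sum_det_updateRow_eq_trace {R : Type*} [CommRing R] {n : ℕ}
    (M B : Matrix (Fin n) (Fin n) R) :
    ∑ j, (M.updateRow j (B j)).det = (B * M.adjugate).trace := by
  rw [← Matrix.trace_transpose, Matrix.transpose_mul, Matrix.adjugate_transpose, Matrix.trace]
  refine Finset.sum_congr rfl fun j _ => ?_
  rw [← Matrix.cramer_transpose_apply, Matrix.cramer_eq_adjugate_mulVec]
  rfl

/-- If the entry `(j, i)` of a matrix is multiplied by `a i + c j`, then the sum over `j` of the
determinants in which only row `j` is changed is `∑ a + ∑ c` times the determinant. -/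
theorem sum_det_updateRow_add_mul {R : Type*} [CommRing R] {n : ℕ}
    (M : Matrix (Fin n) (Fin n) R) (a c : Fin n → R) :
    ∑ j, (M.updateRow j fun i => (a i + c j) * M j i).det = (∑ i, a i + ∑ j, c j) * M.det := by
  have hB : (Matrix.of fun j i => (a i + c j) * M j i) =
      M * Matrix.diagonal a + Matrix.diagonal c * M := by
    ext j i
    simp
    ring
  refine (sum_det_updateRow_eq_trace M (Matrix.of fun j i => (a i + c j) * M j i)).trans ?_
  rw [hB, add_mul, Matrix.trace_add, mul_assoc M, Matrix.trace_mul_comm M, mul_assoc,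
    mul_assoc (Matrix.diagonal c), Matrix.mul_adjugate, Matrix.adjugate_mul]
  simp [Matrix.trace, ← Finset.mul_sum]
  ring

/-- The determinant with the rows `x`, `y` and then the rows of `A`. -/
def consDet {R : Type*} [CommRing R] {k : ℕ} (A : Fin k → Fin (k + 2) → R)
    (x y : Fin (k + 2) → R) : R :=
  Matrix.det (Matrix.of (Fin.cons x (Fin.cons y A : Fin (k + 1) → _) : Fin (k + 2) → _))

theorem consDet_swap {R : Type*} [CommRing R] {k : ℕ} (A : Fin k → Fin (k + 2) → R)
    (x y : Fin (k + 2) → R) : consDet A x y = -consDet A y x := by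
  have h := Matrix.det_permute (Equiv.swap (0 : Fin (k + 2)) 1)
    (Matrix.of (Fin.cons y (Fin.cons x A : Fin (k + 1) → _) : Fin (k + 2) → _))
  rw [Equiv.Perm.sign_swap (by simp)] at h
  unfold consDet
  rw [show -(Matrix.of (Fin.cons y (Fin.cons x A : Fin (k + 1) → _) : Fin (k + 2) → _)).det =
    _ from (by simpa using h.symm)]
  congr 1
  ext i j
  refine Fin.cases ?_ (fun i => Fin.cases ?_ (fun i => ?_) i) i
  · simp
  · simp
  · rw [Matrix.submatrix_apply, Equiv.swap_apply_of_ne_of_ne (by simp) (by simp [Fin.ext_iff])]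
    simp

/-- The three-term Plücker relation for determinants that share all rows but two. It is Cramer's
rule for `b` in terms of the rows `c, d, A`, to which `y ↦ det (a, y, A)` is applied. -/
theorem consDet_plucker {R : Type*} [CommRing R] {k : ℕ} (A : Fin k → Fin (k + 2) → R)
    (a b c d : Fin (k + 2) → R) :
    consDet A a b * consDet A c d - consDet A a c * consDet A b d
      + consDet A a d * consDet A b c = 0 := by
  let φ : (Fin (k + 2) → R) →ₗ[R] R :=
    (Matrix.detRowAlternating (n := Fin (k + 2)) (R := R)).toMultilinearMap.toLinearMap
      (Fin.cons a (Fin.cons 0 A : Fin (k + 1) → _)) 1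
  have hφ : ∀ y, φ y = consDet A a y := by
    intro y
    change Matrix.det (Function.update _ _ _) = Matrix.det _
    congr 1
    rw [← Fin.succ_zero_eq_one, ← Fin.cons_update, Fin.update_cons_zero]
    rfl
  have hA : ∀ i, consDet A a (A i) = 0 := fun i =>
    Matrix.det_zero_of_row_eq (i := 1) (j := i.succ.succ)
      (by rw [← Fin.succ_zero_eq_one]; simp [Fin.ext_iff]) rfl
  set M : Matrix (Fin (k + 2)) (Fin (k + 2)) R :=
    Matrix.of (Fin.cons c (Fin.cons d A : Fin (k + 1) → _) : Fin (k + 2) → _) with hM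
  have key : ∑ i, (M.updateRow i b).det • M i = M.det • b := by
    have := Matrix.mulVec_cramer M.transpose b
    rw [Matrix.det_transpose] at this
    rw [← this]
    ext j
    simp [Matrix.mulVec, dotProduct, Matrix.cramer_transpose_apply, mul_comm]
  have key2 := congrArg φ key
  rw [map_sum, Fin.sum_univ_succ, Fin.sum_univ_succ] at key2
  simp only [map_smul] at key2
  simp only [hφ] at key2
  have h0 : (M.updateRow 0 b).det = consDet A b d := by
    change Matrix.det (Function.update _ _ _) = Matrix.det _
    congr 1
    exact Fin.update_cons_zero ..
  have h1 : (M.updateRow (Fin.succ 0) b).det = consDet A c b := by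
    change Matrix.det (Function.update _ _ _) = Matrix.det _
    congr 1
    refine (Fin.cons_update ..).symm.trans ?_
    rw [Fin.update_cons_zero]
    rfl
  have h2 : ∀ i : Fin k, M i.succ.succ = A i := fun i => rfl
  have h3 : M (Fin.succ 0) = d := rfl
  have h4 : M 0 = c := rfl
  have h5 : M.det = consDet A c d := rfl
  simp only [h0, h1, h2, h3, h4, h5, hA, smul_eq_mul, mul_zero, Finset.sum_const_zero,
    consDet_swap A c b] at key2
  linear_combination -key2

/-! ### The polynomials `p_n(x, 1/2, 0, …)` -/

theorem pPoly_natCast (i : ℕ) : pPoly i = PowerSeries.coeff i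
    ((PowerSeries.exp (MvPolynomial ℕ+ ℚ)).subst timeSeries) := by
  rw [pPoly, if_pos (Int.natCast_nonneg i), Int.toNat_natCast,
    PowerSeries.coeff_subst' hasSubst_timeSeries, PowerSeries.coeff_subst' hasSubst_timeSeries]
  refine finsum_congr fun d => ?_
  rw [PowerSeries.coeff_exp, PowerSeries.coeff_exp, smul_eq_mul, Algebra.smul_def]
  rfl

theorem pPoly_zero : pPoly 0 = 1 := by
  have h := pPoly_natCast 0
  rw [Nat.cast_zero] at h
  rw [h, PowerSeries.coeff_subst' hasSubst_timeSeries, finsum_eq_single _ 0]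
  · simp
  · intro d hd
    simp [timeSeries, hd]

/-- `(n + 1) p_{n+1} = ∑ (k + 1) t_{k+1} p_{n-k}`, which is `E' = E T'` for `E = exp T`. -/
theorem succ_mul_pPoly_succ (n : ℕ) :
    ((n : MvPolynomial ℕ+ ℚ) + 1) * pPoly (n + 1) =
      ∑ k ∈ Finset.range (n + 1),
        MvPolynomial.X k.succPNat * ((k : MvPolynomial ℕ+ ℚ) + 1) * pPoly ((n - k : ℕ) : ℤ) := by
  have h := congrArg (PowerSeries.coeff n) (PowerSeries.derivative_subst
    (f := PowerSeries.exp (MvPolynomial ℕ+ ℚ)) hasSubst_timeSeries)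
  rw [PowerSeries.derivative_exp, PowerSeries.coeff_derivative, mul_comm (PowerSeries.subst _ _),
    PowerSeries.coeff_mul, Finset.Nat.sum_antidiagonal_eq_sum_range_succ_mk] at h
  have h1 := pPoly_natCast (n + 1)
  push_cast at h1
  rw [h1, mul_comm, h]
  refine Finset.sum_congr rfl fun k _ => ?_
  rw [pPoly_natCast, PowerSeries.coeff_derivative]
  simp [timeSeries, Nat.succPNat]

/-- `h_n(x) = p_n(x, 1/2, 0, …)`, the polynomials with generating series `exp (x z + z ^ 2 / 2)`;
up to normalization these are Hermite polynomials of an imaginary argument. -/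
noncomputable def hPoly (n : ℤ) : ℂ[X] :=
  MvPolynomial.aeval (fun k : ℕ+ => if k = 1 then X else if k = 2 then C (1 / 2) else 0) (pPoly n)

theorem hPoly_of_neg {n : ℤ} (hn : n < 0) : hPoly n = 0 := by
  simp [hPoly, pPoly, not_le.2 hn]

theorem hPoly_zero : hPoly 0 = 1 := by
  simp [hPoly, pPoly_zero]

/-- The recurrence of the `h_n`. Together with `derivative_hPoly` it says
`h_n'' + x h_n' = n h_n`. -/
theorem hPoly_sub_two (n : ℤ) : hPoly (n - 2) = (n : ℂ[X]) * hPoly n - X * hPoly (n - 1) := by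
  rcases lt_or_ge n 0 with hn | hn
  · simp [hPoly_of_neg hn, hPoly_of_neg (show n - 1 < 0 by omega),
      hPoly_of_neg (show n - 2 < 0 by omega)]
  obtain ⟨n, rfl⟩ := Int.eq_ofNat_of_zero_le hn
  rcases n with _ | n
  · simp [hPoly_of_neg]
  have h := congrArg (MvPolynomial.aeval (R := ℚ) (fun k : ℕ+ => if k = 1 then (X : ℂ[X])
    else if k = 2 then C (1 / 2) else 0)) (succ_mul_pPoly_succ n)
  simp only [map_mul, map_sum, map_add, map_natCast, map_one, MvPolynomial.aeval_X] at h
  change ((n : ℂ[X]) + 1) * hPoly (n + 1) = ∑ k ∈ _, _ * hPoly _ at h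
  have h1 : ((n : ℂ[X]) + 1) * hPoly (n + 1) = X * hPoly n + hPoly (n - 1) := by
    rw [h]
    have e0 : Nat.succPNat 0 = 1 := rfl
    rcases n with _ | n
    · simp [hPoly_of_neg, e0]
    have h2 : (C (1 / 2 : ℂ)) * (1 + 1) = 1 := by
      rw [one_add_one_eq_two, show (2 : ℂ[X]) = C 2 from rfl, ← C_mul]; norm_num
    have e1 : Nat.succPNat 1 = 2 := rfl
    rw [Finset.sum_range_succ', Finset.sum_range_succ', Finset.sum_eq_zero]
    · have i1 : ((n + 1 : ℕ) : ℤ) - 1 = n := by push_cast; ring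
      have ne : (2 : ℕ+) ≠ 1 := by decide
      simp only [e0, e1, if_neg ne, if_true, i1, zero_add, Nat.cast_one, h2, Nat.add_sub_cancel,
        Nat.sub_zero, Nat.cast_zero]
      ring
    · intro i _
      have n1 : Nat.succPNat (i + 1 + 1) ≠ 1 := fun h => by simpa using congrArg PNat.val h
      have n2 : Nat.succPNat (i + 1 + 1) ≠ 2 := fun h => by
        have := congrArg PNat.val h
        rw [Nat.succPNat_coe] at this
        have h2 : ((2 : ℕ+) : ℕ) = 2 := rfl
        omega
      rw [if_neg n1, if_neg n2, zero_mul, zero_mul]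
  have e2 : ((n + 1 : ℕ) : ℤ) - 2 = n - 1 := by push_cast; ring
  have e1 : ((n + 1 : ℕ) : ℤ) - 1 = n := by push_cast; ring
  rw [e1, e2]
  push_cast
  linear_combination -h1

theorem derivative_hPoly (n : ℤ) : derivative (hPoly n) = hPoly (n - 1) := by
  rcases lt_or_ge n 0 with hn | hn
  · simp [hPoly_of_neg hn, hPoly_of_neg (show n - 1 < 0 by omega)]
  obtain ⟨n, rfl⟩ := Int.eq_ofNat_of_zero_le hn
  induction n using Nat.strong_induction_on with
  | _ n ih =>
  rcases n with _ | n
  · simp [hPoly_of_neg, hPoly_zero]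
  have ih' : ∀ i : ℤ, i < n + 1 → derivative (hPoly i) = hPoly (i - 1) := by
    intro i hi
    rcases lt_or_ge i 0 with h | h
    · simp [hPoly_of_neg h, hPoly_of_neg (show i - 1 < 0 by omega)]
    · obtain ⟨i, rfl⟩ := Int.eq_ofNat_of_zero_le h
      exact ih i (by omega) h
  have h := congrArg derivative (hPoly_sub_two (n + 1))
  have h' := hPoly_sub_two n
  rw [ih' _ (by omega), derivative_sub, derivative_mul, derivative_mul, derivative_X,
    add_sub_cancel_right, ih' n (by omega)] at h
  rw [show (n : ℤ) + 1 - 2 - 1 = n - 2 by ring] at h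
  have hne : ((n : ℂ[X]) + 1) ≠ 0 := by exact_mod_cast Nat.succ_ne_zero n
  apply mul_left_cancel₀ hne
  push_cast
  simp at h h'
  rw [add_sub_cancel_right]
  linear_combination -h + h'

/-! ### The bilinear equation for determinants -/

/-- The determinant with the entry `h_{b i + c j}` in row `j` and column `i`. -/
noncomputable def hDet {n : ℕ} (b c : Fin n → ℤ) : ℂ[X] :=
  Matrix.det (Matrix.of fun j i => hPoly (b i + c j))

theorem hDet_eq_zero {n : ℕ} (b c : Fin n → ℤ) {i j : Fin n} (hij : i ≠ j) (h : c i = c j) :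
    hDet b c = 0 :=
  Matrix.det_zero_of_row_eq hij (by ext; simp [h])

theorem hDet_update {n : ℕ} (b c : Fin n → ℤ) (j : Fin n) (v : ℤ) :
    hDet b (Function.update c j v) =
      ((Matrix.of fun j i => hPoly (b i + c j)).updateRow j fun i => hPoly (b i + v)).det := by
  unfold hDet
  congr 1
  ext k i
  rcases eq_or_ne k j with rfl | h
  · simp
  · simp [h]

theorem derivative_hDet {n : ℕ} (b c : Fin n → ℤ) :
    derivative (hDet b c) = ∑ j, hDet b (Function.update c j (c j - 1)) := by
  rw [hDet, derivative_det_eq_sum_updateRow]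
  refine Finset.sum_congr rfl fun j _ => ?_
  rw [hDet_update]
  simp [derivative_hPoly, add_sub_assoc]

/-- The row-by-row action of `∂ ^ 2`. Since `h_k'' + x h_k' = k h_k`, it is multiplication by the
sum of all `b i` and `c j`, minus `x ∂`. -/
theorem sum_hDet_update_sub_two {n : ℕ} (b c : Fin n → ℤ) :
    ∑ j, hDet b (Function.update c j (c j - 2)) =
      ((∑ i, b i + ∑ j, c j : ℤ) : ℂ[X]) * hDet b c - X * derivative (hDet b c) := by
  rw [derivative_hDet, Finset.mul_sum, eq_sub_iff_add_eq, ← Finset.sum_add_distrib]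
  have h := sum_det_updateRow_add_mul (Matrix.of fun j i => hPoly (b i + c j))
    (fun i => (b i : ℂ[X])) (fun j => (c j : ℂ[X]))
  push_cast
  rw [hDet, ← h]
  refine Finset.sum_congr rfl fun j _ => ?_
  rw [hDet_update, hDet_update, ← Matrix.det_updateRow_smul, ← Matrix.det_updateRow_add]
  congr 2
  ext1 i
  have := hPoly_sub_two (b i + c j)
  push_cast at this
  simp only [Pi.add_apply, Pi.smul_apply, smul_eq_mul, Matrix.of_apply, ← add_sub_assoc, this]
  ring

/-- The row shifts `u, v, r, r + 1, r + 2, …`. -/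
def rowShift {k : ℕ} (r u v : ℤ) : Fin (k + 2) → ℤ :=
  Fin.cons u (Fin.cons v (fun i : Fin k => r + (i : ℤ)) : Fin (k + 1) → ℤ)

theorem rowShift_update_zero {k : ℕ} (r u v w : ℤ) :
    Function.update (rowShift (k := k) r u v) 0 w = rowShift r w v :=
  Fin.update_cons_zero ..

theorem rowShift_update_one {k : ℕ} (r u v w : ℤ) :
    Function.update (rowShift (k := k) r u v) (Fin.succ 0) w = rowShift r u w := by
  refine (Fin.cons_update ..).symm.trans ?_
  rw [Fin.update_cons_zero]
  rfl

theorem rowShift_succ_succ {k : ℕ} (r u v : ℤ) (i : Fin k) :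
    rowShift r u v i.succ.succ = r + (i : ℤ) := rfl

/-- Lowering a shift in the tail of `u, r - 1, r, r + 1, …` by one repeats an entry. -/
theorem hDet_rowShift_sub_one {k : ℕ} (b : Fin (k + 2) → ℤ) (r u : ℤ) (i : Fin k) :
    hDet b (Function.update (rowShift r u (r - 1)) i.succ.succ (r + (i : ℤ) - 1)) = 0 := by
  rcases i with ⟨_ | i, hi⟩
  · refine hDet_eq_zero _ _ (i := Fin.succ ⟨0, by omega⟩) (j := Fin.succ (Fin.succ ⟨0, hi⟩))
      (by simp [Fin.ext_iff]) ?_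
    rw [Function.update_self, Function.update_of_ne (by simp [Fin.ext_iff])]
    change r - 1 = _
    simp
  · refine hDet_eq_zero _ _ (i := Fin.succ (Fin.succ ⟨i, by omega⟩))
      (j := Fin.succ (Fin.succ ⟨i + 1, hi⟩)) (by simp [Fin.ext_iff]) ?_
    rw [Function.update_self, Function.update_of_ne (by simp [Fin.ext_iff]), rowShift_succ_succ]
    push_cast
    ring

/-- Lowering a shift in the tail of `r - 2, r - 1, r, r + 1, …` by two repeats an entry. -/
theorem hDet_rowShift_sub_two {k : ℕ} (b : Fin (k + 2) → ℤ) (r : ℤ) (i : Fin k) :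
    hDet b (Function.update (rowShift r (r - 2) (r - 1)) i.succ.succ (r + (i : ℤ) - 2)) = 0 := by
  rcases i with ⟨_ | _ | i, hi⟩
  · refine hDet_eq_zero _ _ (i := 0) (j := Fin.succ (Fin.succ ⟨0, hi⟩))
      (by simp [Fin.ext_iff]) ?_
    rw [Function.update_self, Function.update_of_ne (by simp [Fin.ext_iff])]
    change r - 2 = _
    simp
  · refine hDet_eq_zero _ _ (i := Fin.succ ⟨0, by omega⟩) (j := Fin.succ (Fin.succ ⟨1, hi⟩))
      (by simp [Fin.ext_iff]) ?_
    rw [Function.update_self, Function.update_of_ne (by simp [Fin.ext_iff])]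
    change r - 1 = _
    push_cast
    ring
  · refine hDet_eq_zero _ _ (i := Fin.succ (Fin.succ ⟨i, by omega⟩))
      (j := Fin.succ (Fin.succ ⟨i + 2, hi⟩)) (by simp [Fin.ext_iff]) ?_
    rw [Function.update_self, Function.update_of_ne (by simp [Fin.ext_iff]), rowShift_succ_succ]
    push_cast
    ring

theorem derivative_hDet_rowShift {k : ℕ} (b : Fin (k + 2) → ℤ) (r u : ℤ) :
    derivative (hDet b (rowShift r u (r - 1))) =
      hDet b (rowShift r (u - 1) (r - 1)) + hDet b (rowShift r u (r - 2)) := by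
  rw [derivative_hDet, Fin.sum_univ_succ, Fin.sum_univ_succ, Finset.sum_eq_zero, add_zero,
    rowShift_update_zero, rowShift_update_one]
  · congr 3
    change r - 1 - 1 = _
    ring
  · exact fun i _ => hDet_rowShift_sub_one b r u i

theorem hDet_rowShift_eq_consDet {k : ℕ} (b : Fin (k + 2) → ℤ) (r u v : ℤ) :
    hDet b (rowShift r u v) = consDet (fun (j : Fin k) i => hPoly (b i + (r + (j : ℤ))))
      (fun i => hPoly (b i + u)) (fun i => hPoly (b i + v)) := by
  unfold hDet consDet
  congr 1
  ext1 j i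
  exact Fin.cases rfl (fun j => Fin.cases rfl (fun j => rfl) j) j

theorem hDet_rowShift_swap {k : ℕ} (b : Fin (k + 2) → ℤ) (r u v : ℤ) :
    hDet b (rowShift r u v) = -hDet b (rowShift r v u) := by
  rw [hDet_rowShift_eq_consDet, hDet_rowShift_eq_consDet, consDet_swap]

theorem hDet_rowShift_self {k : ℕ} (b : Fin (k + 2) → ℤ) (r u : ℤ) :
    hDet b (rowShift r u u) = 0 :=
  hDet_eq_zero _ _ (i := 0) (j := Fin.succ 0) (by simp) rfl

/-- A smaller determinant, bordered by a first row `(1, 0, …, 0)`. -/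
theorem hDet_rowShift_eq_consDet_single {k : ℕ} (b₀ : ℤ) (b : Fin (k + 2) → ℤ) (u : ℤ) :
    hDet b (rowShift 2 u 1) =
      consDet (fun (j : Fin (k + 1)) i => hPoly ((Fin.cons b₀ b : Fin (k + 3) → ℤ) i + (1 + (j : ℤ))))
        (Pi.single 0 1) (fun i => hPoly ((Fin.cons b₀ b : Fin (k + 3) → ℤ) i + u)) := by
  rw [consDet, Matrix.det_succ_row_zero, Finset.sum_eq_single 0]
  · rw [hDet]
    simp only [Fin.val_zero, pow_zero, one_mul, Matrix.of_apply, Fin.cons_zero, Pi.single_eq_same]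
    congr 1
    ext1 j i
    refine Fin.cases ?_ (fun j => Fin.cases ?_ (fun j => ?_) j) j
    · simp [rowShift]
    · change hPoly (b i + 1) = hPoly (b i + (1 + ((0 : ℕ) : ℤ)))
      simp
    · simp [rowShift]
      congr 1
      ring
  · intro i _ hi
    simp [hi]
  · simp

/-- The eigenvalues of `W` and `V` in `hDet_bilinear` differ by `b₀` and this difference of sums. -/
theorem sum_rowShift_one_eq (k : ℕ) :
    ∑ j, rowShift (k := k + 1) 1 (-1) 0 j = ∑ j, rowShift (k := k) 2 0 1 j - 1 := by
  rw [Fin.sum_univ_succ, Fin.sum_univ_succ, Fin.sum_univ_succ, Fin.sum_univ_succ (n := k + 1),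
    Fin.sum_univ_succ (n := k)]
  have h : ∀ i : Fin k, rowShift (k := k + 1) 1 (-1) 0 i.succ.succ.succ =
      rowShift (k := k) 2 0 1 i.succ.succ := by
    intro i
    rw [rowShift_succ_succ, rowShift_succ_succ]
    push_cast [Fin.val_succ]
    ring
  simp only [h]
  change -1 + (0 + (1 + 0 + _)) = 0 + (1 + _) - 1
  ring

/-- The bilinear equation for a determinant `W` and the determinant `V` that has one more index
`b₀`: after `x` is eliminated with `h_k'' + x h_k' = k h_k`, it is a Plücker relation. -/
theorem hDet_bilinear {k : ℕ} (b₀ : ℤ) (b : Fin (k + 2) → ℤ) {W V : ℂ[X]}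
    (hW : W = hDet b (rowShift 2 0 1)) (hV : V = hDet (Fin.cons b₀ b) (rowShift 1 (-1) 0)) :
    derivative (derivative W) * V - 2 * (derivative W * derivative V)
        + W * derivative (derivative V)
      - X * (derivative W * V - W * derivative V) - ((b₀ - 1 : ℤ) : ℂ[X]) * (W * V) = 0 := by
  have dW : derivative W = hDet b (rowShift 2 (-1) 1) := by
    have := derivative_hDet_rowShift b 2 0
    norm_num at this
    rw [hW, this, hDet_rowShift_self, add_zero]
  have ddW : derivative (derivative W) =
      hDet b (rowShift 2 (-2) 1) + hDet b (rowShift 2 (-1) 0) := by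
    have := derivative_hDet_rowShift b 2 (-1)
    norm_num at this
    rw [dW, this]
  have dV : derivative V = hDet (Fin.cons b₀ b) (rowShift 1 (-2) 0) := by
    have := derivative_hDet_rowShift (k := k + 1) (Fin.cons b₀ b) 1 (-1)
    norm_num at this
    rw [hV, this, hDet_rowShift_self, add_zero]
  have ddV : derivative (derivative V) =
      hDet (Fin.cons b₀ b) (rowShift 1 (-3) 0) + hDet (Fin.cons b₀ b) (rowShift 1 (-2) (-1)) := by
    have := derivative_hDet_rowShift (k := k + 1) (Fin.cons b₀ b) 1 (-2)
    norm_num at this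
    rw [dV, this]
  -- the row-by-row action of `∂ ^ 2`: in both determinants only the first two rows contribute
  have heat : ∀ {l : ℕ} (a : Fin (l + 2) → ℤ) (r u v u' v' : ℤ), u = r - 2 → v = r - 1 →
      u' = u - 2 → v' = v - 2 →
      hDet a (rowShift r u' v) + hDet a (rowShift r u v') =
        ((∑ i, a i + ∑ j, rowShift (k := l) r u v j : ℤ) : ℂ[X]) * hDet a (rowShift r u v)
          - X * derivative (hDet a (rowShift r u v)) := by
    rintro l a r u v u' v' rfl rfl rfl rfl
    rw [← sum_hDet_update_sub_two, Fin.sum_univ_succ, Fin.sum_univ_succ, Finset.sum_eq_zero,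
      add_zero, rowShift_update_zero, rowShift_update_one]
    · rfl
    · exact fun i _ => hDet_rowShift_sub_two a r i
  have tW := heat b 2 0 1 (-2) (-1) rfl rfl rfl rfl
  have tV := heat (l := k + 1) (Fin.cons b₀ b) 1 (-1) 0 (-3) (-2) rfl rfl rfl rfl
  rw [Fin.sum_univ_succ (Fin.cons b₀ b : Fin (k + 3) → ℤ), sum_rowShift_one_eq] at tV
  simp only [Fin.cons_zero, Fin.cons_succ] at tV
  rw [← hW, hDet_rowShift_swap b 2 0 (-1)] at tW
  rw [← hV, hDet_rowShift_swap _ 1 (-1) (-2)] at tV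
  -- `W`, `W'` and `(W'' + W_t) / 2` are the brackets `(e, 0)`, `(e, -1)` and `(e, -2)`
  have pl := consDet_plucker
    (fun (j : Fin (k + 1)) i => hPoly ((Fin.cons b₀ b : Fin (k + 3) → ℤ) i + (1 + (j : ℤ))))
    (Pi.single 0 1) (fun i => hPoly ((Fin.cons b₀ b : Fin (k + 3) → ℤ) i + (-2)))
    (fun i => hPoly ((Fin.cons b₀ b : Fin (k + 3) → ℤ) i + (-1)))
    (fun i => hPoly ((Fin.cons b₀ b : Fin (k + 3) → ℤ) i + 0))
  simp only [← hDet_rowShift_eq_consDet_single, ← hDet_rowShift_eq_consDet] at pl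
  rw [← hW, ← dW, ← hV, ← dV] at pl
  push_cast at tW tV ⊢
  linear_combination 2 * pl + V * ddW + W * ddV - V * tW + W * tV

/-! ### Schur polynomials of Maya diagrams as determinants -/

/-- The polynomial `S_μ(x, 1/2, 0, 0, …)` in `x`. -/
noncomputable def schurPoly (μ : YoungDiagram) : ℂ[X] :=
  MvPolynomial.aeval (fun k : ℕ+ => if k = 1 then X else if k = 2 then C (1 / 2) else 0)
    (schurFunction μ)

theorem okamotoS_eq_eval (m n : ℤ) :
    okamotoS m n = fun x => (schurPoly (okamotoPartition m n)).eval x := by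
  funext x
  have h := MvPolynomial.comp_aeval_apply (R := ℚ)
    (fun k : ℕ+ => if k = 1 then (X : ℂ[X]) else if k = 2 then C (1 / 2) else 0)
    ((Polynomial.aeval (R := ℂ) x).restrictScalars ℚ)
    (schurFunction (okamotoPartition m n))
  rw [AlgHom.restrictScalars_apply, Polynomial.coe_aeval_eq_eval] at h
  rw [schurPoly, h, okamotoS]
  congr 2
  funext k
  split_ifs <;> simp

theorem schurPoly_eq_det_colLen (μ : YoungDiagram) :
    schurPoly μ = Matrix.det (Matrix.of fun i j : Fin (μ.colLen 0) =>
      hPoly ((μ.rowLen i : ℤ) - (i : ℤ) + (j : ℤ))) := by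
  rw [schurPoly, schurFunction, AlgHom.map_det]
  rfl

/-- The Jacobi–Trudi determinant does not change when `μ` is padded by empty rows. -/
theorem schurPoly_eq_det (μ : YoungDiagram) (N : ℕ) (hN : μ.colLen 0 ≤ N) :
    schurPoly μ = Matrix.det (Matrix.of fun i j : Fin N =>
      hPoly ((μ.rowLen i : ℤ) - (i : ℤ) + (j : ℤ))) := by
  induction N, hN using Nat.le_induction with
  | base => exact schurPoly_eq_det_colLen μ
  | succ N hN ih =>
    have h0 : μ.rowLen N = 0 := by
      by_contra h
      have h1 : (N, 0) ∈ μ := YoungDiagram.mem_iff_lt_rowLen.2 (Nat.pos_of_ne_zero h)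
      have := YoungDiagram.mem_iff_lt_colLen.1 h1
      omega
    rw [ih, Matrix.det_succ_row _ (Fin.last N), Finset.sum_eq_single (Fin.last N)]
    · simp [h0, hPoly_zero, ← two_mul]
      rfl
    · intro j _ hj
      have : (j : ℕ) < N := by
        have := Fin.val_lt_last hj
        exact this
      rw [Matrix.of_apply, Fin.val_last, h0, hPoly_of_neg (by push_cast; omega)]
      simp
    · simp

/-- If `M` contains all integers below `B` and `b` enumerates its `N` other elements, then the
Schur polynomial of `M` is, up to sign, the determinant of the `h_{b i - B - N + 1 + j}`. -/
theorem schurPoly_eq_hDet {M : Set ℤ} {μ : YoungDiagram} (h : MayaCorresponds M μ) {B : ℤ}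
    (hB : ∀ x < B, x ∈ M) {N : ℕ} {b : Fin N → ℤ} (hb : Function.Injective b)
    (hr : ∀ x, x ∈ Set.range b ↔ x ∈ M ∧ B ≤ x) :
    ∃ u : ℤˣ, schurPoly μ =
      ((u : ℤ) : ℂ[X]) * hDet (fun i => b i - B - N + 1) (fun j => (j : ℤ)) := by
  obtain ⟨e, he, hM, hd⟩ := h
  have hbe : ∀ i, ∃ k, e k = b i := fun i => by
    have := ((hr (b i)).1 ⟨i, rfl⟩).1
    rwa [← hM] at this
  choose g hg using hbe
  have hgi : Function.Injective g := fun i j hij => hb (by rw [← hg, ← hg, hij])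
  -- the indices `i` with `B ≤ e i` are the initial segment `{0, …, N - 1}`
  have hT : ∀ i, i ∈ Finset.univ.image g ↔ B ≤ e i := by
    intro i
    simp only [Finset.mem_image, Finset.mem_univ, true_and]
    constructor
    · rintro ⟨j, rfl⟩
      rw [hg]
      exact ((hr (b j)).1 ⟨j, rfl⟩).2
    · intro hi
      obtain ⟨j, hj⟩ := (hr (e i)).2 ⟨hM ▸ ⟨i, rfl⟩, hi⟩
      exact ⟨j, he.injective (by rw [hg, hj])⟩
  have hcard : (Finset.univ.image g).card = N := by
    rw [Finset.card_image_of_injective _ hgi, Finset.card_fin]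
  have hrange : Finset.univ.image g = Finset.range N := by
    refine Finset.eq_of_subset_of_card_le (fun i hi => ?_) (by simp [hcard])
    have hsub : Finset.range (i + 1) ⊆ Finset.univ.image g := by
      intro j hj
      have := he.antitone (Nat.lt_succ_iff.1 (Finset.mem_range.1 hj))
      exact (hT j).2 (((hT i).1 hi).trans this)
    have := Finset.card_le_card hsub
    rw [hcard, Finset.card_range] at this
    exact Finset.mem_range.2 this
  have hlt : ∀ i, B ≤ e i ↔ i < N := fun i => by rw [← hT, hrange, Finset.mem_range]
  -- from index `N` on, `e` runs through all integers below `B`, so the rows of `μ` are empty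
  have hstep : ∀ i, N ≤ i → e (i + 1) = e i - 1 := by
    intro i hi
    have h1 : e i < B := not_le.1 fun h => absurd ((hlt i).1 h) (by omega)
    have h2 : e i - 1 ∈ Set.range e := hM ▸ hB _ (by omega)
    obtain ⟨j, hj⟩ := h2
    have h3 : i < j := he.lt_iff_gt.1 (by omega)
    have h4 := he.antitone (Nat.succ_le_of_lt h3)
    have h5 := he (Nat.lt_succ_self i)
    rw [Nat.succ_eq_add_one] at h4 h5
    omega
  have hzero : μ.rowLen N = 0 := by
    obtain ⟨K, hK⟩ := exists_rowLen_eq_zero μ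
    have hc : ∀ k, μ.rowLen (N + k) = μ.rowLen N := by
      intro k
      induction k with
      | zero => rfl
      | succ k ih =>
        have h1 := hd (N + k)
        have h2 := hstep (N + k) (by omega)
        rw [← Nat.add_assoc]
        omega
    rw [← hc K]
    exact hK _ (by omega)
  have heN : e N = B - 1 := by
    have h1 : e N < B := not_le.1 fun h => absurd ((hlt N).1 h) (by omega)
    have h2 : B - 1 ∈ Set.range e := hM ▸ hB _ (by omega)
    obtain ⟨j, hj⟩ := h2
    have h3 : N ≤ j := by
      by_contra h
      have := (hlt j).2 (by omega)
      omega
    have := he.antitone h3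
    omega
  have hconst : ∀ i : ℕ, (μ.rowLen i : ℤ) - i - e i = -N - B + 1 := by
    have hc : ∀ i : ℕ, (μ.rowLen i : ℤ) - i - e i = (μ.rowLen 0 : ℤ) - e 0 := by
      intro i
      induction i with
      | zero => simp
      | succ i ih =>
        have := hd i
        push_cast
        omega
    intro i
    have h1 := hc N
    rw [hc i, ← h1, hzero, heN]
    push_cast
    ring
  -- `b` lists the values `e 0, …, e (N - 1)` in another order, whence the sign
  have hgN : ∀ i, g i < N := fun i =>
    Finset.mem_range.1 (hrange ▸ Finset.mem_image_of_mem g (Finset.mem_univ i))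
  let σ : Equiv.Perm (Fin N) := Equiv.ofBijective (fun i => ⟨g i, hgN i⟩)
    (Finite.injective_iff_bijective.1 fun i j hij => hgi (by simpa using hij))
  have hcol : μ.colLen 0 ≤ N := by
    by_contra hlt
    have h1 : (N, 0) ∈ μ := YoungDiagram.mem_iff_lt_colLen.2 (not_le.1 hlt)
    have := YoungDiagram.mem_iff_lt_rowLen.1 h1
    omega
  refine ⟨Equiv.Perm.sign σ, ?_⟩
  have hdet : hDet (fun i => b i - B - N + 1) (fun j => (j : ℤ)) =
      ((Equiv.Perm.sign σ : ℤ) : ℂ[X]) * schurPoly μ := by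
    rw [schurPoly_eq_det μ N hcol, ← Matrix.det_permute, hDet, ← Matrix.det_transpose]
    congr 1
    ext1 i j
    have h1 : (σ i : ℕ) = g i := rfl
    simp only [Matrix.transpose_apply, Matrix.of_apply, Matrix.submatrix_apply, id_eq, h1]
    congr 1
    have := hconst (g i)
    rw [hg] at this
    omega
  rw [hdet, ← mul_assoc, ← Int.cast_mul, Int.units_coe_mul_self, Int.cast_one, one_mul]

/-- The bilinear equation for two Maya diagrams that differ by one element `a`. Here `F` is the part
of `M` from `B` on, so that `B + F.card` is the charge of `M`. -/
theorem schurPoly_bilinear {M : Set ℤ} {μ ν : YoungDiagram} {a B : ℤ} {F : Finset ℤ}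
    (hμ : MayaCorresponds M μ) (hν : MayaCorresponds (insert a M) ν) (ha : a ∉ M)
    (hB : ∀ x < B, x ∈ M) (hF : ∀ x, x ∈ F ↔ x ∈ M ∧ B ≤ x) (hcard : 2 ≤ F.card) :
    derivative (derivative (schurPoly μ)) * schurPoly ν
        - 2 * (derivative (schurPoly μ) * derivative (schurPoly ν))
        + schurPoly μ * derivative (derivative (schurPoly ν))
      - X * (derivative (schurPoly μ) * schurPoly ν - schurPoly μ * derivative (schurPoly ν))
      - ((a - B - F.card : ℤ) : ℂ[X]) * (schurPoly μ * schurPoly ν) = 0 := by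
  obtain ⟨k, hk⟩ := Nat.exists_eq_add_of_le' hcard
  let b : Fin (k + 2) → ℤ := fun i => (F.equivFinOfCardEq hk).symm i
  have hb : Function.Injective b :=
    Subtype.val_injective.comp (F.equivFinOfCardEq hk).symm.injective
  have hr : ∀ x, x ∈ Set.range b ↔ x ∈ M ∧ B ≤ x := by
    intro x
    rw [← hF]
    constructor
    · rintro ⟨i, rfl⟩
      exact ((F.equivFinOfCardEq hk).symm i).2
    · intro hx
      exact ⟨F.equivFinOfCardEq hk ⟨x, hx⟩, by simp [b]⟩
  have haB : B ≤ a := not_lt.1 fun h => ha (hB a h)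
  have hab : a ∉ Set.range b := fun h => ha ((hr a).1 h).1
  have hb' : Function.Injective (Fin.cons a b : Fin (k + 3) → ℤ) :=
    Fin.cons_injective_iff.2 ⟨hab, hb⟩
  have hr' : ∀ x, x ∈ Set.range (Fin.cons a b : Fin (k + 3) → ℤ) ↔ x ∈ insert a M ∧ B ≤ x := by
    intro x
    rw [Fin.range_cons, Set.mem_insert_iff, Set.mem_insert_iff, hr]
    constructor
    · rintro (rfl | h)
      · exact ⟨Or.inl rfl, haB⟩
      · exact ⟨Or.inr h.1, h.2⟩
    · rintro ⟨rfl | h, h'⟩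
      · exact Or.inl rfl
      · exact Or.inr ⟨h, h'⟩
  obtain ⟨u, hu⟩ := schurPoly_eq_hDet hμ hB hb hr
  obtain ⟨v, hv⟩ := schurPoly_eq_hDet hν (fun x hx => Or.inr (hB x hx)) hb' hr'
  have key := hDet_bilinear (a - B - (k + 2 : ℕ) + 1) (fun i => b i - B - (k + 2 : ℕ) + 1)
    (W := hDet (fun i => b i - B - (k + 2 : ℕ) + 1) (fun j => (j : ℤ)))
    (V := hDet (fun i => (Fin.cons a b : Fin (k + 3) → ℤ) i - B - (k + 2 + 1 : ℕ) + 1)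
      (fun j => (j : ℤ))) ?_ ?_
  · rw [hu, hv, hk]
    simp only [derivative_intCast_mul]
    push_cast at key ⊢
    linear_combination ((u : ℤ) : ℂ[X]) * ((v : ℤ) : ℂ[X]) * key
  · congr 1
    funext j
    refine Fin.cases ?_ (fun j => Fin.cases ?_ (fun j => ?_) j) j
    · simp [rowShift]
    · simp [rowShift]
    · rw [rowShift_succ_succ]
      push_cast [Fin.val_succ]
      ring
  · unfold hDet
    congr 1
    ext1 j i
    simp only [Matrix.of_apply]
    congr 1
    have hj : rowShift (k := k + 1) 1 (-1) 0 j = (j : ℤ) - 1 := by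
      refine Fin.cases ?_ (fun j => Fin.cases ?_ (fun j => ?_) j) j
      · simp [rowShift]
      · simp [rowShift]
      · rw [rowShift_succ_succ]
        push_cast [Fin.val_succ]
        ring
    rw [hj]
    refine Fin.cases ?_ (fun i => ?_) i
    · simp only [Fin.cons_zero]
      push_cast
      ring
    · simp only [Fin.cons_succ]
      push_cast
      ring

/-! ### Hirota operators on polynomial functions -/

theorem iteratedDeriv_eval (P : ℂ[X]) (k : ℕ) (x : ℂ) :
    iteratedDeriv k (fun y => P.eval y) x = (derivative^[k] P).eval x := by
  induction k generalizing P with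
  | zero => simp
  | succ k ih =>
    rw [iteratedDeriv_succ', Function.iterate_succ_apply, ← ih]
    congr 1
    funext y
    exact P.deriv

theorem hirotaPIV_eval (c : ℂ) (P Q : ℂ[X]) (x : ℂ) :
    hirotaPIV c (fun x => P.eval x) (fun x => Q.eval x) x =
      (derivative (derivative P) * Q - 2 * (derivative P * derivative Q)
        + P * derivative (derivative Q) - X * (derivative P * Q - P * derivative Q)
        - C c * (P * Q)).eval x := by
  have h : (fun y : ℂ => P.eval (x + y) * Q.eval (x - y)) =
      fun y => (P.comp (C x + X) * Q.comp (C x - X)).eval y := by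
    funext y
    simp
  simp only [hirotaPIV, hirotaD, h, iteratedDeriv_eval, Function.iterate_succ_apply,
    Function.iterate_zero, id_eq, derivative_mul, derivative_comp, derivative_add, derivative_sub,
    derivative_C, derivative_X]
  simp
  ring

/-! ### The Maya diagrams `M(m, n)` -/

theorem mem_okamotoMaya {m n x : ℤ} : x ∈ okamotoMaya m n ↔
    (x % 3 = 0 ∧ x < 3 * m) ∨ (x % 3 = 1 ∧ x < 3 * n + 1) ∨ (x % 3 = 2 ∧ x < 2) := by
  simp only [okamotoMaya, Set.mem_union, Set.mem_image, Set.mem_Iio]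
  constructor
  · rintro ((⟨k, hk, rfl⟩ | ⟨k, hk, rfl⟩) | ⟨k, hk, rfl⟩) <;> omega
  · rintro (h | h | h)
    · exact Or.inl (Or.inl ⟨x / 3, by omega, by omega⟩)
    · exact Or.inl (Or.inr ⟨x / 3, by omega, by omega⟩)
    · exact Or.inr ⟨x / 3, by omega, by omega⟩

/-- Below a suitable bound `B` the diagram `M(m, n)` is full, and it has `m + n - B` elements
from `B` on. -/
theorem exists_finset_okamotoMaya (m n : ℤ) : ∃ (B : ℤ) (F : Finset ℤ),
    (∀ x < B, x ∈ okamotoMaya m n) ∧ (∀ x, x ∈ F ↔ x ∈ okamotoMaya m n ∧ B ≤ x) ∧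
      2 ≤ F.card ∧ (F.card : ℤ) = m + n - B := by
  obtain ⟨L, h0, hm, hn⟩ : ∃ L : ℤ, 2 ≤ L ∧ -L ≤ m ∧ -L ≤ n := by
    refine ⟨2 + |m| + |n|, ?_, ?_, ?_⟩ <;>
    have h1 := neg_abs_le m <;> have h2 := neg_abs_le n <;> have h3 := abs_nonneg m <;>
      have h4 := abs_nonneg n <;> omega
  let F : Finset ℤ := ((Finset.Ico (-L) m).image (fun k => 3 * k) ∪
    (Finset.Ico (-L) n).image (fun k => 3 * k + 1)) ∪
    (Finset.Ico (-L) 0).image (fun k => 3 * k + 2)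
  have hcard : (F.card : ℤ) = m + n - -3 * L := by
    rw [Finset.card_union_of_disjoint, Finset.card_union_of_disjoint,
      Finset.card_image_of_injective _ (fun a b h => by simpa using h),
      Finset.card_image_of_injective _ (fun a b h => by simpa using h),
      Finset.card_image_of_injective _ (fun a b h => by simpa using h)]
    · simp only [Int.card_Ico]
      omega
    · rw [Finset.disjoint_left]
      simp only [Finset.mem_image]
      rintro x ⟨k, -, rfl⟩ ⟨l, -, h⟩
      omega
    · rw [Finset.disjoint_left]
      simp only [Finset.mem_image, Finset.mem_union]
      rintro x (⟨k, -, rfl⟩ | ⟨k, -, rfl⟩) ⟨l, -, h⟩ <;> omega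
  refine ⟨-3 * L, F, fun x hx => ?_, fun x => ?_, by omega, hcard⟩
  · rw [mem_okamotoMaya]
    omega
  · rw [mem_okamotoMaya]
    simp only [F, Finset.mem_union, Finset.mem_image, Finset.mem_Ico]
    constructor
    · rintro ((⟨k, hk, rfl⟩ | ⟨k, hk, rfl⟩) | ⟨k, hk, rfl⟩) <;> omega
    · rintro ⟨h | h | h, hB⟩
      · exact Or.inl (Or.inl ⟨x / 3, by omega, by omega⟩)
      · exact Or.inl (Or.inr ⟨x / 3, by omega, by omega⟩)
      · exact Or.inr ⟨x / 3, by omega, by omega⟩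

theorem insert_okamotoMaya_left (m n : ℤ) :
    insert (3 * m) (okamotoMaya m n) = okamotoMaya (m + 1) n := by
  ext x
  rw [Set.mem_insert_iff, mem_okamotoMaya, mem_okamotoMaya]
  omega

theorem insert_okamotoMaya_right (m n : ℤ) :
    insert (3 * n + 1) (okamotoMaya m n) = okamotoMaya m (n + 1) := by
  ext x
  rw [Set.mem_insert_iff, mem_okamotoMaya, mem_okamotoMaya]
  omega

/-- Adding `2` to `M(m + 1, n + 1)` gives the translate `M(m, n) + 3`. -/
theorem mayaCorresponds_insert_two {m n : ℤ} {μ : YoungDiagram}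
    (h : MayaCorresponds (okamotoMaya m n) μ) :
    MayaCorresponds (insert 2 (okamotoMaya (m + 1) (n + 1))) μ := by
  obtain ⟨e, he, hr, hd⟩ := h
  refine ⟨fun i => e i + 3, fun i j hij => by simpa using he hij, ?_, fun i => ?_⟩
  · ext x
    have h1 : x ∈ Set.range (fun i => e i + 3) ↔ x - 3 ∈ Set.range e :=
      ⟨fun ⟨i, hi⟩ => ⟨i, by simp only at hi; omega⟩, fun ⟨i, hi⟩ => ⟨i, by simp only; omega⟩⟩
    rw [h1, hr, Set.mem_insert_iff, mem_okamotoMaya, mem_okamotoMaya]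
    omega
  · rw [← hd i]
    ring

/-- The bilinear equation for `M(m, n)`, whose charge is `m + n`, and one more element `a`. -/
theorem hirotaPIV_schurPoly {m n a : ℤ} {μ ν : YoungDiagram} {c : ℂ}
    (hμ : MayaCorresponds (okamotoMaya m n) μ)
    (hν : MayaCorresponds (insert a (okamotoMaya m n)) ν) (ha : a ∉ okamotoMaya m n)
    (hc : c = ((a - m - n : ℤ) : ℂ)) (x : ℂ) :
    hirotaPIV c (fun x => (schurPoly μ).eval x) (fun x => (schurPoly ν).eval x) x = 0 := by
  obtain ⟨B, F, hB, hF, h2, hcard⟩ := exists_finset_okamotoMaya m n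
  have h := schurPoly_bilinear hμ hν ha hB hF h2
  rw [show a - B - (F.card : ℤ) = a - m - n by omega] at h
  rw [hirotaPIV_eval, hc, ← Polynomial.eval_zero (x := x), ← h]
  congr 3

theorem mainTheorem7 (m n : ℤ) :
    SolvesBilinearPIV (3 * (m : ℂ) + 1) (3 * ((n : ℂ) - (m : ℂ)) + 1) (-3 * (n : ℂ) + 1)
        (okamotoS m n) (okamotoS (m + 1) n) (okamotoS (m + 1) (n + 1)) ∧
      SolvesBilinearPIV (3 * (n : ℂ) + 2) (3 * ((m : ℂ) - (n : ℂ)) - 1) (-3 * (m : ℂ) + 2)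
        (okamotoS m n) (okamotoS m (n + 1)) (okamotoS (m + 1) (n + 1)) := by
  have hspec : ∀ m n : ℤ, MayaCorresponds (okamotoMaya m n) (okamotoPartition m n) :=
    fun m n => (isMaya_okamotoMaya m n).partition_spec
  have hdiff : ∀ m n : ℤ, Differentiable ℂ (okamotoS m n) := fun m n => by
    rw [okamotoS_eq_eval]
    exact Polynomial.differentiable _
  have hleft : ∀ (m n : ℤ) (c : ℂ), c = ((3 * m - m - n : ℤ) : ℂ) →
      ∀ x, hirotaPIV c (okamotoS m n) (okamotoS (m + 1) n) x = 0 := by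
    intro m n c hc x
    rw [okamotoS_eq_eval, okamotoS_eq_eval]
    refine hirotaPIV_schurPoly (hspec m n) ?_ (by rw [mem_okamotoMaya]; omega) hc x
    rw [insert_okamotoMaya_left]
    exact hspec _ _
  have hright : ∀ (m n : ℤ) (c : ℂ), c = ((3 * n + 1 - m - n : ℤ) : ℂ) →
      ∀ x, hirotaPIV c (okamotoS m n) (okamotoS m (n + 1)) x = 0 := by
    intro m n c hc x
    rw [okamotoS_eq_eval, okamotoS_eq_eval]
    refine hirotaPIV_schurPoly (hspec m n) ?_ (by rw [mem_okamotoMaya]; omega) hc x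
    rw [insert_okamotoMaya_right]
    exact hspec _ _
  have hback : ∀ (m n : ℤ) (c : ℂ), c = ((2 - (m + 1) - (n + 1) : ℤ) : ℂ) →
      ∀ x, hirotaPIV c (okamotoS (m + 1) (n + 1)) (okamotoS m n) x = 0 := by
    intro m n c hc x
    rw [okamotoS_eq_eval, okamotoS_eq_eval]
    exact hirotaPIV_schurPoly (hspec _ _) (mayaCorresponds_insert_two (hspec m n))
      (by rw [mem_okamotoMaya]; omega) hc x
  refine ⟨⟨hdiff _ _, hdiff _ _, hdiff _ _, hleft m n _ ?_, hright (m + 1) n _ ?_,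
    hback m n _ ?_⟩, ⟨hdiff _ _, hdiff _ _, hdiff _ _, hright m n _ ?_, hleft m (n + 1) _ ?_,
    hback m n _ ?_⟩⟩
  all_goals (push_cast; ring)
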